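/- Definitions. A subset of a monoid is rational if it is obtained from finite subsets by finitely many unions, products and generations of submonoids. Let $S$ be a semigroup and let $A$ be a finite alphabet with a map $A\to S$ whose image generates $S$; let $\mu:A^+\to S$ be the induced homomorphism. A quasi-automatic structure on $S$ with respect to $A$ consists of a language $L\subset A^+$ that is rational (in $A^*$) and of relations $R,R_a\subset A^+\times A^+$ ($a\in A$) that are rational (in $A^*\times A^*$), such that $\mu(L)=S$, $R=\{(u,v)\in L\times L\mid \mu(u)=\mu(v)\}$ and $R_a=\{(u,v)\in L\times L\mid \mu(ua)=\mu(v)\}$ for each $a\in A$. The semigroup $S$ is quasi-automatic if it has a quasi-automatic structure with respect to some finite generating subset. If $S$ is a monoid, extend $\mu$ to $A^*$ by $\mu(1)=1$; the triple $(S,A,L)$ has the weak Lipschitz property with constant $P\in\mathbb N$ if for all $u,v\in L$ such that $\mu(u),\mu(v)$ are at distance at most $1$ in the undirected Cayley graph of $S$ with respect to $A$, there are $n\ge 0$ and $a_1,\dots,a_n,b_1,\dots,b_n\in A\cup\{1\}$ such that $a_i=1\Leftrightarrow b_i\ne 1$ for each $i$, such that $u=a_1\cdots a_n$ and $v=b_1\cdots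 b_n$ in $A^*$, and such that $\mu(a_1\cdots a_i)$ and $\mu(b_1\cdots b_i)$ are at distance at most $P$ for $i=0,\dots,n$. For a homomorphism $\nu$ from a free group $F(A)$ to a group and a set $E\subset\ker\nu$, we say that $E$ satisfies an exponential isoperimetric inequality if there is a constant $C$ such that each $g\in\ker\nu$, of reduced length $k$, is a product of at most $C^k$ elements of the form $yxy^{-1}$ with $y\in F(A)$, $x\in E$. Theorem. Let $G$ be a group which is a quasi-automatic semigroup. Then $G$ is finitely presented as a group, with an exponential isoperimetric inequality: there are a finite set $A$, a surjective homomorphism $\nu:F(A)\to G$ and a finite set $E\subset F(A)$ whose normal closure is $\ker\nu$ and which satisfies an exponential isoperimetric inequality. More precisely, let $A$ be any nonempty finite set, let $\nu:F(A)\to G$ be any surjective homomorphism, and let $B=A\sqcup A^{-1}$, with the natural map $B\to G$ induced by $\nu$. Then $G$ has a quasi-automatic structure with respect to $B$. For each such structure, with language of representatives $L$, there is a constant $P$ such that $(G,B,L)$ has the weak Lipschitz property with constant $P$; and for every such $P$, the set of elements of $\ker\nu$ of reduced length at most $2P+2$ is finite, its normal closure is $\ker\nu$, and it satisfies an exponential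 isoperimetric inequality. -/

import Mathlib

/-- Rational subsets of a monoid: the smallest family that contains the finite subsets and is
closed under union, product and generation of submonoids (`E ↦ E^*`). -/
inductive IsRationalSubset {M : Type*} [Monoid M] : Set M → Prop
  | finite (E : Set M) : E.Finite → IsRationalSubset E
  | union (E F : Set M) : IsRationalSubset E → IsRationalSubset F → IsRationalSubset (E ∪ F)
  | mul (E F : Set M) : IsRationalSubset E → IsRationalSubset F →
      IsRationalSubset (Set.image2 (fun x y => x * y) E F)
  | star (E : Set M) : IsRationalSubset E → IsRationalSubset (Submonoid.closure E : Set M)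

/-- The inclusion `A^+ ⊆ A^*` of the free semigroup into the free monoid. -/
def plusToStar {A : Type*} : FreeSemigroup A →ₙ* FreeMonoid A :=
  FreeSemigroup.lift FreeMonoid.of

/-- A set of nonempty words is a rational language if it is a rational subset of `A^*`. -/
def IsRationalLanguage {A : Type*} (L : Set (FreeSemigroup A)) : Prop :=
  IsRationalSubset (plusToStar '' L)

/-- A subset of `A^+ × A^+` is a rational relation if it is a rational subset of the monoid
`A^* × A^*`. -/
def IsRationalRelation {A : Type*} (R : Set (FreeSemigroup A × FreeSemigroup A)) : Prop :=
  IsRationalSubset (Prod.map plusToStar plusToStar '' R)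

/-- A quasi-automatic structure on the semigroup `S` with respect to the family of generators
`f : A → S`. Here `μ = FreeSemigroup.lift f : A^+ → S` is the natural homomorphism. -/
structure QuasiAutomaticStructure {A S : Type*} [Semigroup S] (f : A → S) where
  /-- the language of representatives -/
  L : Set (FreeSemigroup A)
  /-- equality of representatives -/
  R : Set (FreeSemigroup A × FreeSemigroup A)
  /-- right multiplication by a generator -/
  Rgen : A → Set (FreeSemigroup A × FreeSemigroup A)
  rational_L : IsRationalLanguage L
  rational_R : IsRationalRelation R
  rational_Rgen : ∀ a, IsRationalRelation (Rgen a)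
  surj : FreeSemigroup.lift f '' L = Set.univ
  R_eq : R = {p | p.1 ∈ L ∧ p.2 ∈ L ∧ FreeSemigroup.lift f p.1 = FreeSemigroup.lift f p.2}
  Rgen_eq : ∀ a, Rgen a = {p | p.1 ∈ L ∧ p.2 ∈ L ∧
    FreeSemigroup.lift f (p.1 * FreeSemigroup.of a) = FreeSemigroup.lift f p.2}

/-- A semigroup is quasi-automatic if it has a quasi-automatic structure with respect to some
finite generating subset. -/
def IsQuasiAutomatic (S : Type*) [Semigroup S] : Prop :=
  ∃ A : Set S, A.Finite ∧ Subsemigroup.closure A = ⊤ ∧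
    Nonempty (QuasiAutomaticStructure (Subtype.val : A → S))

/-- The undirected Cayley graph of a monoid with respect to a family of elements: `g` and `h` are
adjacent if they are distinct and `g * f b = h` or `h * f b = g` for some `b`. -/
def cayleyGraph {B M : Type*} [Monoid M] (f : B → M) : SimpleGraph M :=
  SimpleGraph.fromRel (fun g h => ∃ b, g * f b = h)

/-- The triple `(M, B, L)` has the weak Lipschitz property with constant `P`. The pairs
`(aᵢ, bᵢ)` of elements of `B ∪ {1}` are the entries of the list `c`, with `none` in the role of
the empty word `1`; `List.reduceOption` erases the entries `none`. -/
def WeakLipschitzWith {B M : Type*} [Monoid M] (f : B → M) (L : Set (FreeSemigroup B))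
    (P : ℕ) : Prop :=
  ∀ u ∈ L, ∀ v ∈ L,
    (cayleyGraph f).edist (FreeSemigroup.lift f u) (FreeSemigroup.lift f v) ≤ 1 →
    ∃ c : List (Option B × Option B),
      (∀ x ∈ c, (x.1 = none ↔ x.2 ≠ none)) ∧
      plusToStar u = FreeMonoid.ofList (c.map Prod.fst).reduceOption ∧
      plusToStar v = FreeMonoid.ofList (c.map Prod.snd).reduceOption ∧
      ∀ i ≤ c.length,
        (cayleyGraph f).edist
          (FreeMonoid.lift f (FreeMonoid.ofList ((c.take i).map Prod.fst).reduceOption))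
          (FreeMonoid.lift f (FreeMonoid.ofList ((c.take i).map Prod.snd).reduceOption)) ≤ P

/-- For `ν : F(A) → G`, the family of generators of `G` indexed by `B = A ⊔ A⁻¹`: the letter
`(a, true)` stands for `a` and is sent to `ν a`, the letter `(a, false)` stands for `a⁻¹` and is
sent to `(ν a)⁻¹`. -/
def signedGenerators {A G : Type*} [Group G] (ν : FreeGroup A →* G) : A × Bool → G :=
  fun x => ν (FreeGroup.mk [x])

/-- The relators of `ν : F(A) → G` of (reduced) length at most `m`. -/
def relatorsUpTo {A G : Type*} [DecidableEq A] [Group G] (ν : FreeGroup A →* G) (m : ℕ) :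
    Set (FreeGroup A) :=
  {x | ν x = 1 ∧ x.norm ≤ m}

/-- Exponential isoperimetric inequality for the set `E` of relators of `ν : F(A) → G`: for some
`C`, each element `g` of the kernel, of reduced length `k`, is a product of at most `C ^ k`
elements of the form `y * x * y⁻¹` with `y ∈ F(A)`, `x ∈ E`. -/
def ExponentialIsoperimetricInequality {A G : Type*} [DecidableEq A] [Group G]
    (ν : FreeGroup A →* G) (E : Set (FreeGroup A)) : Prop :=
  ∃ C : ℕ, ∀ g ∈ ν.ker, ∃ l : List (FreeGroup A × FreeGroup A),
    l.length ≤ C ^ g.norm ∧ (∀ p ∈ l, p.2 ∈ E) ∧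
      (l.map (fun p => p.1 * p.2 * p.1⁻¹)).prod = g

/-! A rational relation between representatives controls two things: how far apart the paths of
related words can drift, and how long the shortest related word must be. The first gives relators of
bounded length, the second an exponential bound on their number.

Fellow travelling (`IsRationalRelation.exists_fellowTravel`): a rational relation is the projection
of a rational language over two disjoint copies of the alphabet, and a word of that language
prescribes the order in which the letters of `u` and `v` are read. Every prefix of it can be
completed within the language by boundedly many letters. The elements reached midway are therefore
close to the values of some related pair, which are close to each other. Applied to `R` and all
`R_a`, this is the weak Lipschitz property.

Filling (`isConjProd_of_fellowTravel`): connecting words of length at most `P` cut the region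
between the paths of `u` and `v` into cells with boundary of length at most `2 * P + 2`, about one
for each letter of `u` and `v`. Let `g` be a relator of length `k`, and choose a representative for
each of its prefixes. The strips between consecutive representatives fill `g`. By
`QuasiAutomaticStructure.exists_successor_bound`, the representatives can be chosen so that each is
at most linearly longer than the preceding one; they and the number of cells then grow at most
exponentially in `k`.

Change of generators (`QuasiAutomaticStructure.nonempty_of_generators`): right multiplication by a
word is a composition of the relations `R_a`. Rational relations are closed under composition
because rational languages over finite alphabets are closed under inverse images and intersections,
which follows from their characterization by finitely many left quotients. -/

/-! ### Rational subsets under homomorphisms; languages with finitely many quotients are rational -/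

namespace IsRationalSubset

variable {M N : Type*} [Monoid M] [Monoid N]

/-- Rational subsets are preserved by monoid homomorphisms. -/
theorem image (φ : M →* N) {E : Set M} (h : IsRationalSubset E) : IsRationalSubset (φ '' E) := by
  induction h with
  | finite E hE => exact .finite _ (hE.image _)
  | union E F _ _ hE hF => rw [Set.image_union]; exact .union _ _ hE hF
  | mul E F _ _ hE hF =>
    rw [Set.image_image2_distrib (g := φ) (f' := fun x y => x * y) (g₁ := φ) (g₂ := φ) (map_mul φ)]
    exact .mul _ _ hE hF
  | star E _ hE =>
    have : φ '' (Submonoid.closure E : Set M) = Submonoid.closure (φ '' E) := by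
      rw [← MonoidHom.map_mclosure, Submonoid.coe_map]
    rw [this]
    exact .star _ hE

/-- Rational subsets lift along surjective homomorphisms. -/
theorem exists_image_eq {φ : M →* N} (hφ : Function.Surjective φ) {F : Set N}
    (h : IsRationalSubset F) : ∃ E, IsRationalSubset E ∧ φ '' E = F := by
  induction h with
  | finite F hF =>
    refine ⟨Function.surjInv hφ '' F, .finite _ (hF.image _), ?_⟩
    simp [Set.image_image, Function.surjInv_eq]
  | union E F _ _ hE hF =>
    obtain ⟨E', hE, rfl⟩ := hE
    obtain ⟨F', hF, rfl⟩ := hF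
    exact ⟨_, .union _ _ hE hF, Set.image_union ..⟩
  | mul E F _ _ hE hF =>
    obtain ⟨E', hE, rfl⟩ := hE
    obtain ⟨F', hF, rfl⟩ := hF
    exact ⟨_, .mul _ _ hE hF, Set.image_image2_distrib (by simp)⟩
  | star E _ hE =>
    obtain ⟨E', hE, rfl⟩ := hE
    refine ⟨_, .star _ hE, ?_⟩
    rw [← MonoidHom.map_mclosure, Submonoid.coe_map]

/-- Sums of rational languages, seen as subsets of a free monoid, are rational. -/
theorem language_add {α : Type*} {K L : Language α}
    (hK : IsRationalSubset (M := FreeMonoid α) K) (hL : IsRationalSubset (M := FreeMonoid α) L) :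
    IsRationalSubset (M := FreeMonoid α) (K + L : Language α) :=
  .union (M := FreeMonoid α) _ _ hK hL

theorem language_mul {α : Type*} {K L : Language α}
    (hK : IsRationalSubset (M := FreeMonoid α) K) (hL : IsRationalSubset (M := FreeMonoid α) L) :
    IsRationalSubset (M := FreeMonoid α) (K * L : Language α) :=
  .mul (M := FreeMonoid α) _ _ hK hL

theorem _root_.FreeMonoid.coe_closure_eq_kstar {α : Type*} (K : Language α) :
    (Submonoid.closure (M := FreeMonoid α) K : Set (FreeMonoid α)) = (KStar.kstar K : Language α) := by
  ext x
  rw [SetLike.mem_coe]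
  constructor
  · intro hx
    obtain ⟨l, hl, rfl⟩ := Submonoid.exists_list_of_mem_closure hx
    exact ⟨l, FreeMonoid.toList_prod l |>.trans (congrArg _ (List.map_id _)), hl⟩
  · rintro ⟨l, rfl, hl⟩
    have : (l.flatten : List α) = (show List (FreeMonoid α) from l).prod :=
      ((FreeMonoid.toList_prod (α := α) l).trans (congrArg _ (List.map_id _))).symm
    rw [this]
    exact Submonoid.list_prod_mem _ fun x hx => Submonoid.subset_closure (hl x hx)

theorem language_kstar {α : Type*} {K : Language α} (hK : IsRationalSubset (M := FreeMonoid α) K) :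
    IsRationalSubset (M := FreeMonoid α) (KStar.kstar K : Language α) :=
  FreeMonoid.coe_closure_eq_kstar K ▸ .star (M := FreeMonoid α) _ hK

theorem language_sum {α ι : Type*} (s : Finset ι) {K : ι → Language α}
    (hK : ∀ i, IsRationalSubset (M := FreeMonoid α) (K i)) :
    IsRationalSubset (M := FreeMonoid α) (∑ i ∈ s, K i : Language α) := by
  classical
  induction s using Finset.induction_on with
  | empty => exact .finite (M := FreeMonoid α) _ Set.finite_empty
  | insert i s hi ih => rw [Finset.sum_insert hi]; exact language_add (hK i) ih

open Computability in
/-- The components of a solution of a system of linear equations `X i = ∑ j, E i j * X j + F i`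
with rational coefficients are rational languages if no `E i j` contains the empty word. -/
theorem of_linear_system {α : Type*} : ∀ (n : ℕ) (E : Fin n → Fin n → Language α)
    (F X : Fin n → Language α), (∀ i j, IsRationalSubset (M := FreeMonoid α) (E i j)) →
    (∀ i j, [] ∉ E i j) → (∀ i, IsRationalSubset (M := FreeMonoid α) (F i)) →
    (∀ i, X i = ∑ j, E i j * X j + F i) → ∀ i, IsRationalSubset (M := FreeMonoid α) (X i)
  | 0, _, _, _, _, _, _, _ => fun i => i.elim0
  | n + 1, E, F, X, hE, hE', hF, hX => by
    -- Arden's lemma solves the equation of `X 0`, since `E 0 0` lacks the empty word. Substituting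
    -- the solution into the other equations leaves a system with `n` unknowns.
    have h0 : X 0 = (E 0 0)∗ * (∑ j : Fin n, E 0 j.succ * X j.succ + F 0) := by
      refine (Language.self_eq_mul_add_iff (hE' 0 0)).1 ?_
      conv_lhs => rw [hX 0, Fin.sum_univ_succ]
      rw [add_assoc]
    have hS : ∀ i : Fin n, IsRationalSubset (M := FreeMonoid α) (X i.succ) := by
      refine of_linear_system n (fun i j => E i.succ 0 * (E 0 0)∗ * E 0 j.succ + E i.succ j.succ)
        (fun i => E i.succ 0 * (E 0 0)∗ * F 0 + F i.succ) (fun i => X i.succ) ?_ ?_ ?_ ?_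
      · exact fun i j => language_add (language_mul (language_mul (hE _ _)
          (language_kstar (hE _ _))) (hE _ _)) (hE _ _)
      · rintro i j (h | h)
        · obtain ⟨a, -, b, hb, hab⟩ := h
          exact hE' _ _ ((List.append_eq_nil_iff.1 hab).2 ▸ hb)
        · exact hE' _ _ h
      · exact fun i => language_add (language_mul (language_mul (hE _ _)
          (language_kstar (hE _ _))) (hF _)) (hF _)
      · intro i
        conv_lhs => rw [hX i.succ, Fin.sum_univ_succ, h0]
        simp only [add_mul, Finset.sum_add_distrib, mul_add, Finset.mul_sum, mul_assoc]
        abel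
    refine Fin.cases ?_ hS
    rw [h0]
    exact language_mul (language_kstar (hE _ _)) (language_add
      (language_sum _ fun j => language_mul (hE _ _) (hS j)) (hF _))

/-- A language over a finite alphabet with finitely many left quotients is rational. -/
theorem of_finite_range_leftQuotient {α : Type*} [Finite α] {K : Language α}
    (h : (Set.range K.leftQuotient).Finite) : IsRationalSubset (M := FreeMonoid α) K := by
  have := h.to_subtype
  obtain ⟨n, ⟨e⟩⟩ := Finite.exists_equiv_fin (Set.range K.leftQuotient)
  -- The automaton whose states are the quotients: `E i j` consists of the letters that lead from
  -- state `i` to state `j`, and `F i` contains the empty word exactly when state `i` is accepting.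
  obtain ⟨E, hE⟩ : ∃ E : Fin n → Fin n → Language α, ∀ i j x, x ∈ E i j ↔
      ∃ a, x = [a] ∧ (e.symm i).1.leftQuotient [a] = (e.symm j).1 :=
    ⟨fun i j => {x | ∃ a, x = [a] ∧ (e.symm i).1.leftQuotient [a] = (e.symm j).1},
      fun _ _ _ => Iff.rfl⟩
  obtain ⟨F, hF⟩ : ∃ F : Fin n → Language α, ∀ i x, x ∈ F i ↔ x = [] ∧ [] ∈ (e.symm i).1 :=
    ⟨fun i => {x | x = [] ∧ [] ∈ (e.symm i).1}, fun _ _ => Iff.rfl⟩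
  have key := of_linear_system n E F (fun i => (e.symm i).1) ?_ ?_ ?_ ?_
  · have hK := key (e ⟨K, [], rfl⟩)
    rwa [e.symm_apply_apply] at hK
  · refine fun i j => .finite (M := FreeMonoid α) _ ((Set.finite_range fun a : α => [a]).subset ?_)
    intro x hx
    obtain ⟨a, rfl, -⟩ := (hE i j x).1 hx
    exact ⟨a, rfl⟩
  · intro i j h
    obtain ⟨a, ha, -⟩ := (hE i j _).1 h
    exact absurd ha (by simp)
  · exact fun i => .finite (M := FreeMonoid α) _ ((Set.finite_singleton ([] : List α)).subset
      fun x hx => ((hF i x).1 hx).1)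
  · intro i
    ext x
    have hsum : ∀ (s : Finset (Fin n)) (f : Fin n → Language α),
        x ∈ ∑ j ∈ s, f j ↔ ∃ j ∈ s, x ∈ f j := by
      intro s f
      induction s using Finset.induction_on with
      | empty => simp [Language.notMem_zero]
      | insert j s hj ih => simp [Finset.sum_insert hj, Language.mem_add, ih]
    rw [Language.mem_add, hsum, hF]
    simp only [Language.mem_mul, hE]
    clear hE hF hsum
    obtain ⟨Y, w, rfl⟩ := e.symm i
    dsimp only
    cases x with
    | nil =>
      refine ⟨fun h => .inr ⟨rfl, h⟩, ?_⟩
      rintro (⟨j, -, y, ⟨a, rfl, -⟩, z, -, hz⟩ | h)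
      · simp at hz
      · exact h.2
    | cons a x =>
      constructor
      · refine fun h => .inl ⟨e ⟨K.leftQuotient (w ++ [a]), _, rfl⟩, Finset.mem_univ _, [a],
          ⟨a, rfl, ?_⟩, x, ?_, rfl⟩
        · rw [e.symm_apply_apply]
          exact (Language.leftQuotient_append K w [a]).symm
        · rw [e.symm_apply_apply]
          simpa [Language.mem_leftQuotient] using h
      · rintro (⟨j, -, y, ⟨b, rfl, hb⟩, z, hz, hyz⟩ | h)
        · obtain ⟨rfl, rfl⟩ : b = a ∧ z = x := by simpa using hyz
          rw [← hb] at hz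
          exact hz
        · exact absurd h.1 (by simp)

end IsRationalSubset

/-! ### Rational languages have finitely many quotients; inverse images and intersections -/

theorem FreeMonoid.mul_eq_mul_iff {α : Type*} {x y z w : FreeMonoid α} :
    x * y = z * w ↔ (∃ t, z = x * t ∧ y = t * w) ∨ ∃ t, x = z * t ∧ w = t * y :=
  List.append_eq_append_iff

/-- For a rational subset `E` of a free monoid, there are finitely many sets `w⁻¹ E`. -/
theorem IsRationalSubset.finite_range_quotient {α : Type*} {E : Set (FreeMonoid α)}
    (h : IsRationalSubset E) : (Set.range fun w : FreeMonoid α => {y | w * y ∈ E}).Finite := by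
  induction h with
  | finite E hE =>
    have hfin : (⋃ x ∈ E, {y : FreeMonoid α | ∃ w, w * y = x}).Finite := by
      refine hE.biUnion fun x _ => (List.finite_toSet (FreeMonoid.toList x).tails).subset ?_
      rintro y ⟨w, rfl⟩
      exact (List.mem_tails _ _).2 ⟨w, rfl⟩
    refine hfin.finite_subsets.subset ?_
    rintro _ ⟨w, rfl⟩ y hy
    exact Set.mem_biUnion hy ⟨w, rfl⟩
  | union E F _ _ hE hF =>
    refine (hE.image2 (fun x y => x ∪ y) hF).subset ?_
    rintro _ ⟨w, rfl⟩
    exact ⟨_, ⟨w, rfl⟩, _, ⟨w, rfl⟩, rfl⟩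
  | mul E F _ _ hE hF =>
    -- The quotient of `E F` by `w` is `(w⁻¹ E) F` together with the sets `s⁻¹ F` for the
    -- factorizations `w = w₁ * s` with `w₁ ∈ E`. It is determined by one quotient of `E` and a set
    -- of quotients of `F`.
    refine (hE.image2 (fun X T => Set.image2 (fun x y => x * y) X F ∪ ⋃₀ T)
      hF.finite_subsets).subset ?_
    rintro _ ⟨w, rfl⟩
    refine ⟨_, ⟨w, rfl⟩, {T | ∃ w₁ s, w = w₁ * s ∧ w₁ ∈ E ∧ T = {y | s * y ∈ F}}, ?_, ?_⟩
    · rintro _ ⟨w₁, s, -, -, rfl⟩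
      exact ⟨s, rfl⟩
    · ext y
      constructor
      · rintro (⟨a, ha, b, hb, rfl⟩ | ⟨_, ⟨w₁, s, rfl, hw, rfl⟩, hy⟩)
        · exact ⟨w * a, ha, b, hb, mul_assoc ..⟩
        · exact ⟨w₁, hw, s * y, hy, (mul_assoc ..).symm⟩
      · rintro ⟨a, ha, b, hb, hab⟩
        obtain ⟨t, rfl, rfl⟩ | ⟨t, rfl, rfl⟩ := FreeMonoid.mul_eq_mul_iff.1 hab
        · exact .inr ⟨_, ⟨a, t, rfl, ha, rfl⟩, hb⟩
        · exact .inl ⟨t, ha, b, hb, rfl⟩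
  | star E _ hE =>
    -- For `w ≠ 1`, the quotient of `E^*` by `w` is `(⋃ s⁻¹ E) E^*`, over the factorizations `w = w₁
    -- * s` with `w₁ ∈ E^*`. Only `w = 1` needs the additional value `E^*`.
    refine ((hE.finite_subsets.image fun T => Set.image2 (fun x y => x * y) (⋃₀ T)
      (Submonoid.closure E : Set (FreeMonoid α))).insert
      (Submonoid.closure E : Set (FreeMonoid α))).subset ?_
    rintro _ ⟨w, rfl⟩
    by_cases hw : w = 1
    · subst hw
      exact .inl (by simp)
    refine .inr ⟨{T | ∃ w₁ s, w = w₁ * s ∧ w₁ ∈ Submonoid.closure E ∧ T = {y | s * y ∈ E}}, ?_, ?_⟩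
    · rintro _ ⟨w₁, s, -, -, rfl⟩
      exact ⟨s, rfl⟩
    · ext y
      constructor
      · rintro ⟨y₁, ⟨_, ⟨w₁, s, rfl, hw₁, rfl⟩, hy₁⟩, y₂, hy₂, rfl⟩
        have : w₁ * (s * y₁) * y₂ ∈ Submonoid.closure E :=
          mul_mem (mul_mem hw₁ (Submonoid.subset_closure hy₁)) hy₂
        simpa [mul_assoc] using this
      · intro hy
        obtain ⟨l, hl, hly⟩ := Submonoid.exists_list_of_mem_closure (x := w * y) hy
        clear hy
        -- Factors are removed from the left until one of them reaches the end of `w`; that factor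
        -- is split as `s * y₁`.
        induction l generalizing w with
        | nil => exact absurd (List.append_eq_nil_iff.1 hly.symm).1 hw
        | cons e l ih =>
          have he := hl e List.mem_cons_self
          have hl' : ∀ x ∈ l, x ∈ E := fun x hx => hl x (List.mem_cons_of_mem _ hx)
          rw [List.prod_cons] at hly
          obtain ⟨t, rfl, ht⟩ | ⟨t, rfl, ht⟩ := FreeMonoid.mul_eq_mul_iff.1 hly
          -- If `w` ends exactly where `e` does, nothing is left for the induction, and `s = e`, `y₁
          -- = 1` will do.
          · by_cases ht1 : t = 1
            · subst ht1
              refine ⟨1, ⟨_, ⟨1, e, by simp, one_mem _, rfl⟩, by simpa using he⟩, l.prod,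
                Submonoid.list_prod_mem _ fun x hx => Submonoid.subset_closure (hl' x hx), ?_⟩
              simpa using ht
            · obtain ⟨y₁, ⟨_, ⟨w₁, s, rfl, hw₁, rfl⟩, hy₁⟩, y₂, hy₂, hy⟩ := ih t ht1 hl' ht
              exact ⟨y₁, ⟨_, ⟨e * w₁, s, by rw [mul_assoc],
                mul_mem (Submonoid.subset_closure he) hw₁, rfl⟩, hy₁⟩, y₂, hy₂, hy⟩
          · exact ⟨t, ⟨_, ⟨1, w, by simp, one_mem _, rfl⟩, he⟩, l.prod,
              Submonoid.list_prod_mem _ fun x hx => Submonoid.subset_closure (hl' x hx), ht.symm⟩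

namespace IsRationalSubset

variable {α β γ : Type*}

theorem of_finite_range_quotient [Finite α] {E : Set (FreeMonoid α)}
    (h : (Set.range fun w : FreeMonoid α => {y | w * y ∈ E}).Finite) : IsRationalSubset E :=
  of_finite_range_leftQuotient (K := E) h

/-- Inverse images of rational subsets of free monoids under homomorphisms are rational. -/
theorem preimage [Finite α] (φ : FreeMonoid α →* FreeMonoid β) {E : Set (FreeMonoid β)}
    (h : IsRationalSubset E) : IsRationalSubset (φ ⁻¹' E) := by
  refine of_finite_range_quotient ((h.finite_range_quotient.image (φ ⁻¹' ·)).subset ?_)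
  rintro _ ⟨w, rfl⟩
  exact ⟨_, ⟨φ w, rfl⟩, by ext; simp⟩

/-- Rational subsets of a finitely generated free monoid are closed under intersection. -/
theorem inter [Finite α] {E F : Set (FreeMonoid α)} (hE : IsRationalSubset E)
    (hF : IsRationalSubset F) : IsRationalSubset (E ∩ F) := by
  refine of_finite_range_quotient
    ((hE.finite_range_quotient.image2 (· ∩ ·) hF.finite_range_quotient).subset ?_)
  rintro _ ⟨w, rfl⟩
  exact ⟨_, ⟨w, rfl⟩, _, ⟨w, rfl⟩, rfl⟩

end IsRationalSubset

/-! ### Composition of rational relations -/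

namespace FreeMonoid

variable {α β γ : Type*}

/-- The projection `(α ⊔ β)^* → α^* × β^*`. -/
def toProd : FreeMonoid (α ⊕ β) →* FreeMonoid α × FreeMonoid β :=
  lift (Sum.elim (fun a => (of a, 1)) (fun b => (1, of b)))

@[simp] theorem toProd_of_inl (a : α) : toProd (of (.inl a : α ⊕ β)) = (of a, 1) := rfl

@[simp] theorem toProd_of_inr (b : β) : toProd (of (.inr b : α ⊕ β)) = (1, of b) := rfl

theorem toProd_surjective : Function.Surjective (toProd (α := α) (β := β)) := by
  rintro ⟨u, v⟩
  refine ⟨map Sum.inl u * map Sum.inr v, ?_⟩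
  have h₁ : toProd.comp (map Sum.inl) = MonoidHom.inl (FreeMonoid α) (FreeMonoid β) :=
    hom_eq fun _ => rfl
  have h₂ : toProd.comp (map Sum.inr) = MonoidHom.inr (FreeMonoid α) (FreeMonoid β) :=
    hom_eq fun _ => rfl
  have h₁' := DFunLike.congr_fun h₁ u
  have h₂' := DFunLike.congr_fun h₂ v
  simp only [MonoidHom.comp_apply] at h₁' h₂'
  simp [h₁', h₂']

/-- The homomorphism `(α ⊔ β ⊔ γ)^* → (α ⊔ β)^*` that erases the letters of `γ`. -/
def eraseRight : FreeMonoid (α ⊕ β ⊕ γ) →* FreeMonoid (α ⊕ β) :=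
  lift (Sum.elim (fun a => of (.inl a)) (Sum.elim (fun b => of (.inr b)) fun _ => 1))

/-- The homomorphism `(α ⊔ β ⊔ γ)^* → (β ⊔ γ)^*` that erases the letters of `α`. -/
def eraseLeft : FreeMonoid (α ⊕ β ⊕ γ) →* FreeMonoid (β ⊕ γ) :=
  lift (Sum.elim (fun _ => 1) of)

/-- The projection `(α ⊔ β ⊔ γ)^* → α^* × γ^*`. -/
def toProdOuter : FreeMonoid (α ⊕ β ⊕ γ) →* FreeMonoid α × FreeMonoid γ :=
  lift (Sum.elim (fun a => (of a, 1)) (Sum.elim (fun _ => 1) fun c => (1, of c)))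

theorem toProdOuter_fst (w : FreeMonoid (α ⊕ β ⊕ γ)) :
    (toProdOuter w).1 = (toProd (eraseRight w)).1 := by
  have : (MonoidHom.fst _ _).comp toProdOuter =
      (MonoidHom.fst (FreeMonoid α) (FreeMonoid β)).comp (toProd.comp (eraseRight (γ := γ))) :=
    hom_eq (by rintro (a | b | c) <;> rfl)
  exact DFunLike.congr_fun this w

theorem toProdOuter_snd (w : FreeMonoid (α ⊕ β ⊕ γ)) :
    (toProdOuter w).2 = (toProd (eraseLeft w)).2 := by
  have : (MonoidHom.snd _ _).comp toProdOuter =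
      (MonoidHom.snd (FreeMonoid β) (FreeMonoid γ)).comp (toProd.comp (eraseLeft (α := α))) :=
    hom_eq (by rintro (a | b | c) <;> rfl)
  exact DFunLike.congr_fun this w

theorem toProd_eraseRight_snd (w : FreeMonoid (α ⊕ β ⊕ γ)) :
    (toProd (eraseRight w)).2 = (toProd (eraseLeft w)).1 := by
  have : (MonoidHom.snd (FreeMonoid α) (FreeMonoid β)).comp (toProd.comp (eraseRight (γ := γ))) =
      (MonoidHom.fst (FreeMonoid β) (FreeMonoid γ)).comp (toProd.comp (eraseLeft (α := α))) :=
    hom_eq (by rintro (a | b | c) <;> rfl)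
  exact DFunLike.congr_fun this w

/-- The two words are shuffled: letters of `α` and `γ` are inserted as they come, while a letter of
`β` is consumed from both words at once, which is possible because their `β`-parts agree. -/
theorem exists_eraseRight_eq_eraseLeft_eq (w₁ : FreeMonoid (α ⊕ β)) (w₂ : FreeMonoid (β ⊕ γ))
    (h : (toProd w₁).2 = (toProd w₂).1) :
    ∃ w : FreeMonoid (α ⊕ β ⊕ γ), eraseRight w = w₁ ∧ eraseLeft w = w₂ := by
  induction w₁ using FreeMonoid.inductionOn' generalizing w₂ with
  | one =>
    induction w₂ using FreeMonoid.inductionOn' with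
    | one => exact ⟨1, map_one _, map_one _⟩
    | of_mul x w₂ ih =>
      obtain b | c := x
      · exact absurd (congrArg length h) (by simp; omega)
      · obtain ⟨w, h₁, h₂⟩ := ih (by simpa using h)
        exact ⟨of (.inr (.inr c)) * w, by rw [map_mul, h₁]; rfl, by rw [map_mul, h₂]; rfl⟩
  | of_mul y w₁ ih₁ =>
    obtain a | b := y
    · obtain ⟨w, h₁, h₂⟩ := ih₁ w₂ (by simpa using h)
      exact ⟨of (.inl a) * w, by rw [map_mul, h₁]; rfl, by rw [map_mul, h₂]; rfl⟩
    induction w₂ using FreeMonoid.inductionOn' with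
    | one => exact absurd (congrArg length h) (by simp)
    | of_mul x w₂ ih =>
      obtain b' | c := x
      · have hb : b :: (toProd w₁).2.toList = b' :: (toProd w₂).1.toList := by
          simpa using congrArg toList h
        obtain ⟨rfl, hb'⟩ := List.cons.inj hb
        obtain ⟨w, h₁, h₂⟩ := ih₁ w₂ hb'
        exact ⟨of (.inr (.inl b)) * w, by rw [map_mul, h₁]; rfl, by rw [map_mul, h₂]; rfl⟩
      · obtain ⟨w, h₁, h₂⟩ := ih (by simpa using h)
        exact ⟨of (.inr (.inr c)) * w, by rw [map_mul, h₁]; rfl, by rw [map_mul, h₂]; rfl⟩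

end FreeMonoid

open FreeMonoid in
/-- Compositions of rational relations between finitely generated free monoids are rational. -/
theorem IsRationalSubset.comp {α β γ : Type*} [Finite α] [Finite β] [Finite γ]
    {R : Set (FreeMonoid α × FreeMonoid β)} {S : Set (FreeMonoid β × FreeMonoid γ)}
    (hR : IsRationalSubset R) (hS : IsRationalSubset S) :
    IsRationalSubset {p : FreeMonoid α × FreeMonoid γ | ∃ y, (p.1, y) ∈ R ∧ (y, p.2) ∈ S} := by
  obtain ⟨K, hK, rfl⟩ := hR.exists_image_eq (φ := toProd) toProd_surjective
  obtain ⟨K', hK', rfl⟩ := hS.exists_image_eq (φ := toProd) toProd_surjective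
  -- A word over the three alphabets encodes a triple `(x, y, z)`. Membership of `(x, y)` and `(y,
  -- z)` becomes an intersection of two inverse images, and erasing `y` is a homomorphism.
  convert ((hK.preimage (eraseRight (γ := γ))).inter (hK'.preimage (eraseLeft (α := α)))).image
    toProdOuter using 1
  ext ⟨x, z⟩
  constructor
  · rintro ⟨y, ⟨w₁, hw₁, h₁⟩, w₂, hw₂, h₂⟩
    obtain ⟨w, rfl, rfl⟩ := exists_eraseRight_eq_eraseLeft_eq w₁ w₂ (by rw [h₁, h₂])
    refine ⟨w, ⟨hw₁, hw₂⟩, Prod.ext ?_ ?_⟩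
    · rw [toProdOuter_fst, h₁]
    · rw [toProdOuter_snd, h₂]
  · rintro ⟨w, ⟨hw₁, hw₂⟩, h⟩
    refine ⟨(toProd (eraseRight w)).2, ⟨_, hw₁, Prod.ext ?_ rfl⟩, _, hw₂, Prod.ext ?_ ?_⟩
    · rw [← toProdOuter_fst, h]
    · exact (toProd_eraseRight_snd w).symm
    · rw [← toProdOuter_snd, h]

/-! ### Nonempty words and change of generators -/

@[simp] theorem plusToStar_of {A : Type*} (a : A) :
    plusToStar (FreeSemigroup.of a) = FreeMonoid.of a := rfl

theorem toList_plusToStar {A : Type*} (u : FreeSemigroup A) :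
    FreeMonoid.toList (plusToStar u) = u.head :: u.tail := by
  induction u using FreeSemigroup.recOnMul with
  | ih1 a => rfl
  | ih2 a u _ hu => rw [map_mul, FreeMonoid.toList_mul, hu]; rfl

theorem plusToStar_injective {A : Type*} : Function.Injective (plusToStar (A := A)) := by
  intro u v h
  have h' := congrArg FreeMonoid.toList h
  rw [toList_plusToStar, toList_plusToStar] at h'
  obtain ⟨h₁, h₂⟩ := List.cons.inj h'
  exact FreeSemigroup.ext h₁ h₂

theorem lift_plusToStar {A M : Type*} [Monoid M] (f : A → M) (u : FreeSemigroup A) :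
    FreeMonoid.lift f (plusToStar u) = FreeSemigroup.lift f u := by
  induction u using FreeSemigroup.recOnMul with
  | ih1 a => simp
  | ih2 a u _ hu => simp only [map_mul, hu]; simp

theorem plusToStar_lift {A B : Type*} (φ : A → FreeSemigroup B) (u : FreeSemigroup A) :
    plusToStar (FreeSemigroup.lift φ u) =
      FreeMonoid.lift (fun a => plusToStar (φ a)) (plusToStar u) := by
  induction u using FreeSemigroup.recOnMul with
  | ih1 a => simp
  | ih2 a u _ hu => simp only [map_mul, hu]; simp

theorem IsRationalLanguage.image {A B : Type*} (φ : A → FreeSemigroup B)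
    {L : Set (FreeSemigroup A)} (h : IsRationalLanguage L) :
    IsRationalLanguage (FreeSemigroup.lift φ '' L) := by
  have := IsRationalSubset.image (FreeMonoid.lift fun a => plusToStar (φ a)) h
  rw [Set.image_image] at this
  rw [IsRationalLanguage, Set.image_image]
  simpa only [plusToStar_lift] using this

theorem IsRationalRelation.image {A B : Type*} (φ : A → FreeSemigroup B)
    {R : Set (FreeSemigroup A × FreeSemigroup A)} (h : IsRationalRelation R) :
    IsRationalRelation (Prod.map (FreeSemigroup.lift φ) (FreeSemigroup.lift φ) '' R) := by
  have := IsRationalSubset.image (MonoidHom.prodMap (FreeMonoid.lift fun a => plusToStar (φ a))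
    (FreeMonoid.lift fun a => plusToStar (φ a))) h
  rw [Set.image_image] at this
  rw [IsRationalRelation, Set.image_image]
  convert this using 3 with p
  exact Prod.ext (plusToStar_lift φ p.1) (plusToStar_lift φ p.2)

theorem IsRationalRelation.comp {A : Type*} [Finite A]
    {R S : Set (FreeSemigroup A × FreeSemigroup A)}
    (hR : IsRationalRelation R) (hS : IsRationalRelation S) :
    IsRationalRelation {p | ∃ y, (p.1, y) ∈ R ∧ (y, p.2) ∈ S} := by
  rw [IsRationalRelation]
  convert IsRationalSubset.comp hR hS using 1
  ext ⟨u, v⟩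
  constructor
  · rintro ⟨⟨x, z⟩, ⟨y, hxy, hyz⟩, h⟩
    obtain ⟨rfl, rfl⟩ := Prod.mk.inj h
    exact ⟨plusToStar y, ⟨_, hxy, rfl⟩, ⟨_, hyz, rfl⟩⟩
  · rintro ⟨y, ⟨⟨x, y₁⟩, hxy, h₁⟩, ⟨y₂, z⟩, hyz, h₂⟩
    obtain ⟨rfl, rfl⟩ := Prod.mk.inj h₁
    obtain ⟨h, rfl⟩ := Prod.mk.inj h₂
    obtain rfl := plusToStar_injective h
    exact ⟨(x, z), ⟨_, hxy, hyz⟩, rfl⟩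

namespace QuasiAutomaticStructure

variable {A B S : Type*} [Semigroup S] {f : A → S}

theorem exists_mem_lift_eq (Q : QuasiAutomaticStructure f) (s : S) : ∃ u ∈ Q.L, FreeSemigroup.lift f u = s :=
  (Q.surj ▸ Set.mem_univ s : s ∈ FreeSemigroup.lift f '' Q.L)

/-- Right multiplication by any element is a rational relation on representatives. -/
theorem rational_mul [Finite A] (Q : QuasiAutomaticStructure f) (w : FreeSemigroup A) :
    IsRationalRelation {p : FreeSemigroup A × FreeSemigroup A | p.1 ∈ Q.L ∧ p.2 ∈ Q.L ∧
      FreeSemigroup.lift f (p.1 * w) = FreeSemigroup.lift f p.2} := by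
  induction w using FreeSemigroup.recOnMul with
  | ih1 a => exact Q.Rgen_eq a ▸ Q.rational_Rgen a
  | ih2 a w ha hw =>
    convert ha.comp hw using 1
    ext ⟨u, v⟩
    constructor
    · rintro ⟨hu, hv, h⟩
      obtain ⟨y, hy, hy'⟩ := Q.exists_mem_lift_eq (FreeSemigroup.lift f (u * FreeSemigroup.of a))
      exact ⟨y, ⟨hu, hy, hy'.symm⟩, hy, hv, by rw [map_mul, hy', ← map_mul, mul_assoc, h]⟩
    · rintro ⟨y, ⟨hu, hy, h₁⟩, -, hv, h₂⟩
      refine ⟨hu, hv, ?_⟩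
      dsimp only at h₁ h₂ ⊢
      rw [← mul_assoc, map_mul, h₁, ← map_mul, h₂]

/-- A quasi-automatic structure can be transported to any other generating family. -/
theorem nonempty_of_generators [Finite A] (Q : QuasiAutomaticStructure f) {g : B → S}
    (hf : ∀ a, ∃ w : FreeSemigroup B, FreeSemigroup.lift g w = f a)
    (hg : ∀ b, ∃ w : FreeSemigroup A, FreeSemigroup.lift f w = g b) :
    Nonempty (QuasiAutomaticStructure g) := by
  choose φ hφ using hf
  choose w hw using hg
  have hlift : ∀ u, FreeSemigroup.lift g (FreeSemigroup.lift φ u) = FreeSemigroup.lift f u := by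
    intro u
    induction u using FreeSemigroup.recOnMul with
    | ih1 a => simp [hφ]
    | ih2 a u _ hu => simp only [map_mul, hu]; simp [hφ]
  -- Substituting `φ` preserves values, so multiplication by the new generator `b` is the image of
  -- multiplication by the old word `w b`.
  have himage : ∀ b, {p : FreeSemigroup B × FreeSemigroup B |
      p.1 ∈ FreeSemigroup.lift φ '' Q.L ∧ p.2 ∈ FreeSemigroup.lift φ '' Q.L ∧
      FreeSemigroup.lift g (p.1 * FreeSemigroup.of b) = FreeSemigroup.lift g p.2} =
      Prod.map (FreeSemigroup.lift φ) (FreeSemigroup.lift φ) ''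
        {p : FreeSemigroup A × FreeSemigroup A | p.1 ∈ Q.L ∧ p.2 ∈ Q.L ∧
          FreeSemigroup.lift f (p.1 * w b) = FreeSemigroup.lift f p.2} := by
    intro b
    ext ⟨u, v⟩
    constructor
    · rintro ⟨⟨u, hu, rfl⟩, ⟨v, hv, rfl⟩, h⟩
      refine ⟨(u, v), ⟨hu, hv, ?_⟩, rfl⟩
      simpa [hlift, hw] using h
    · rintro ⟨⟨u, v⟩, ⟨hu, hv, h⟩, h'⟩
      obtain ⟨rfl, rfl⟩ := Prod.mk.inj h'
      refine ⟨⟨u, hu, rfl⟩, ⟨v, hv, rfl⟩, ?_⟩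
      simpa [hlift, hw] using h
  exact ⟨{
    L := FreeSemigroup.lift φ '' Q.L
    R := Prod.map (FreeSemigroup.lift φ) (FreeSemigroup.lift φ) '' Q.R
    Rgen := fun b => {p | p.1 ∈ FreeSemigroup.lift φ '' Q.L ∧ p.2 ∈ FreeSemigroup.lift φ '' Q.L ∧
      FreeSemigroup.lift g (p.1 * FreeSemigroup.of b) = FreeSemigroup.lift g p.2}
    rational_L := Q.rational_L.image φ
    rational_R := Q.rational_R.image φ
    rational_Rgen := fun b => himage b ▸ (Q.rational_mul (w b)).image φ
    surj := by rw [Set.image_image, ← Q.surj]; simp only [hlift]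
    R_eq := by
      rw [Q.R_eq]
      ext ⟨u, v⟩
      constructor
      · rintro ⟨⟨u, v⟩, ⟨hu, hv, h⟩, h'⟩
        obtain ⟨rfl, rfl⟩ := Prod.mk.inj h'
        exact ⟨⟨u, hu, rfl⟩, ⟨v, hv, rfl⟩, by simpa [hlift] using h⟩
      · rintro ⟨⟨u, hu, rfl⟩, ⟨v, hv, rfl⟩, h⟩
        exact ⟨(u, v), ⟨hu, hv, by simpa [hlift] using h⟩, rfl⟩
    Rgen_eq := fun _ => rfl }⟩

end QuasiAutomaticStructure

theorem exists_lift_eq_of_closure_eq_top {S : Type*} [Semigroup S] {A : Set S}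
    (hA : Subsemigroup.closure A = ⊤) (s : S) :
    ∃ w : FreeSemigroup A, FreeSemigroup.lift (Subtype.val : A → S) w = s := by
  have : Subsemigroup.closure A ≤ (FreeSemigroup.lift (Subtype.val : A → S)).srange :=
    Subsemigroup.closure_le.2 fun a ha => ⟨FreeSemigroup.of ⟨a, ha⟩, by simp⟩
  exact this (hA ▸ Subsemigroup.mem_top s)

theorem exists_lift_signedGenerators_eq {A G : Type*} [Group G] [Nonempty A] {ν : FreeGroup A →* G}
    (hν : Function.Surjective ν) (g : G) :
    ∃ w : FreeSemigroup (A × Bool), FreeSemigroup.lift (signedGenerators ν) w = g := by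
  obtain ⟨x, rfl⟩ := hν g
  have hmul : ∀ u v : FreeSemigroup (A × Bool), FreeSemigroup.lift (signedGenerators ν) (u * v) =
    FreeSemigroup.lift (signedGenerators ν) u * FreeSemigroup.lift (signedGenerators ν) v :=
    fun u v => map_mul _ u v
  induction x using FreeGroup.induction_on with
  | C1 =>
    -- The empty word is not available, so the identity is spelled `a a⁻¹`.
    obtain ⟨a⟩ := ‹Nonempty A›
    refine ⟨FreeSemigroup.of (a, true) * FreeSemigroup.of (a, false), ?_⟩
    rw [hmul, FreeSemigroup.lift_of, FreeSemigroup.lift_of, signedGenerators, signedGenerators,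
      ← map_mul]
    congr 1
    exact mul_inv_cancel (FreeGroup.of a)
  | of a => exact ⟨FreeSemigroup.of (a, true), rfl⟩
  | inv_of a _ => exact ⟨FreeSemigroup.of (a, false), rfl⟩
  | mul x y hx hy =>
    obtain ⟨u, hu⟩ := hx
    obtain ⟨v, hv⟩ := hy
    exact ⟨u * v, by rw [hmul, hu, hv, map_mul]⟩

/-! ### Length bounds by induction on rational expressions -/

/-- In a rational language, prefixes of words can be completed by words of bounded length. -/
theorem IsRationalSubset.exists_completion_bound {α : Type*} {K : Set (FreeMonoid α)}
    (h : IsRationalSubset K) :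
    ∃ N : ℕ, ∀ x y, x * y ∈ K → ∃ s : FreeMonoid α, s.length ≤ N ∧ x * s ∈ K := by
  induction h with
  | finite K hK =>
    obtain ⟨N, hN⟩ := (hK.image FreeMonoid.length).bddAbove
    refine ⟨N, fun x y hxy => ⟨y, ?_, hxy⟩⟩
    have := hN ⟨_, hxy, rfl⟩
    rw [FreeMonoid.length_mul] at this
    omega
  | union E F _ _ hE hF =>
    obtain ⟨m, hm⟩ := hE
    obtain ⟨n, hn⟩ := hF
    refine ⟨max m n, ?_⟩
    rintro x y (hxy | hxy)
    · obtain ⟨s, hs, hxs⟩ := hm x y hxy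
      exact ⟨s, hs.trans (le_max_left _ _), .inl hxs⟩
    · obtain ⟨s, hs, hxs⟩ := hn x y hxy
      exact ⟨s, hs.trans (le_max_right _ _), .inr hxs⟩
  | mul E F _ _ hE hF =>
    obtain ⟨m, hm⟩ := hE
    obtain ⟨n, hn⟩ := hF
    -- If `x` ends inside the factor from `E`, the word `f₀`, fixed in advance, supplies the factor
    -- from `F`.
    obtain rfl | ⟨f₀, hf₀⟩ := F.eq_empty_or_nonempty
    · exact ⟨0, fun x y hxy => by simp at hxy⟩
    refine ⟨m + f₀.length + n, ?_⟩
    rintro x y ⟨e, he, f, hf, hef⟩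
    obtain ⟨t, rfl, rfl⟩ | ⟨t, rfl, rfl⟩ := FreeMonoid.mul_eq_mul_iff.1 hef
    · obtain ⟨s, hs, hts⟩ := hn t y hf
      exact ⟨s, by omega, e, he, t * s, hts, (mul_assoc ..).symm⟩
    · obtain ⟨s, hs, hxs⟩ := hm x t he
      exact ⟨s * f₀, by rw [FreeMonoid.length_mul]; omega, x * s, hxs, f₀, hf₀, mul_assoc ..⟩
  | star E _ hE =>
    obtain ⟨n, hn⟩ := hE
    refine ⟨n, fun x y hxy => ?_⟩
    obtain ⟨l, hl, hxy⟩ := Submonoid.exists_list_of_mem_closure hxy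
    induction l generalizing x with
    | nil =>
      obtain rfl : x = 1 := (List.append_eq_nil_iff.1 hxy.symm).1
      exact ⟨1, by simp, by simp⟩
    | cons e l ih =>
      rw [List.prod_cons] at hxy
      have he := hl e List.mem_cons_self
      obtain ⟨t, rfl, ht⟩ | ⟨t, rfl, ht⟩ := FreeMonoid.mul_eq_mul_iff.1 hxy
      · obtain ⟨s, hs, hts⟩ := ih t (ht ▸ Submonoid.list_prod_mem _ fun z hz =>
          Submonoid.subset_closure (hl z (List.mem_cons_of_mem _ hz)))
          (fun z hz => hl z (List.mem_cons_of_mem _ hz)) ht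
        exact ⟨s, hs, by rw [mul_assoc]; exact mul_mem (Submonoid.subset_closure he) hts⟩
      · obtain ⟨s, hs, hxs⟩ := hn x t he
        exact ⟨s, hs, Submonoid.subset_closure hxs⟩

/-- If `(u, v)` belongs to a rational relation, then some `(u, v')` with `v'` of length at most
linear in the length of `u` also does. -/
theorem IsRationalSubset.exists_length_bound {α β : Type*} {R : Set (FreeMonoid α × FreeMonoid β)}
    (h : IsRationalSubset R) :
    ∃ C : ℕ, ∀ p ∈ R, ∃ v, (p.1, v) ∈ R ∧ v.length ≤ C * (p.1.length + 1) := by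
  induction h with
  | finite R hR =>
    obtain ⟨N, hN⟩ := (hR.image fun p => p.2.length).bddAbove
    refine ⟨N, fun p hp => ⟨p.2, hp, ?_⟩⟩
    exact (hN ⟨p, hp, rfl⟩ : p.2.length ≤ N).trans (Nat.le_mul_of_pos_right _ (Nat.succ_pos _))
  | union E F _ _ hE hF =>
    obtain ⟨m, hm⟩ := hE
    obtain ⟨n, hn⟩ := hF
    refine ⟨max m n, ?_⟩
    rintro p (hp | hp)
    · obtain ⟨v, hv, hl⟩ := hm p hp
      exact ⟨v, .inl hv, hl.trans (Nat.mul_le_mul_right _ (le_max_left _ _))⟩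
    · obtain ⟨v, hv, hl⟩ := hn p hp
      exact ⟨v, .inr hv, hl.trans (Nat.mul_le_mul_right _ (le_max_right _ _))⟩
  | mul E F _ _ hE hF =>
    obtain ⟨m, hm⟩ := hE
    obtain ⟨n, hn⟩ := hF
    refine ⟨m + n, ?_⟩
    rintro _ ⟨p, hp, q, hq, rfl⟩
    obtain ⟨v, hv, hvl⟩ := hm p hp
    obtain ⟨w, hw, hwl⟩ := hn q hq
    refine ⟨v * w, ⟨_, hv, _, hw, rfl⟩, ?_⟩
    simp only [Prod.fst_mul, FreeMonoid.length_mul]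
    nlinarith
  | star E _ hE =>
    obtain ⟨n, hn⟩ := hE
    refine ⟨2 * n, fun p hp => ?_⟩
    -- Without the summand `1` the bound is additive, hence passes to products of arbitrarily many
    -- factors. A factor with empty first component is replaced by the identity; for the others, `n
    -- * (k + 1) ≤ 2 * n * k` because `k ≥ 1`.
    suffices ∃ v, (p.1, v) ∈ Submonoid.closure E ∧ v.length ≤ 2 * n * p.1.length by
      obtain ⟨v, hv, hvl⟩ := this
      exact ⟨v, hv, hvl.trans (Nat.mul_le_mul_left _ (Nat.le_succ _))⟩
    induction hp using Submonoid.closure_induction with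
    | mem p hp =>
      obtain ⟨v, hv, hvl⟩ := hn p hp
      obtain h0 | h0 := Nat.eq_zero_or_pos p.1.length
      · exact ⟨1, by rw [FreeMonoid.length_eq_zero.1 h0]; exact one_mem _, by simp⟩
      · exact ⟨v, Submonoid.subset_closure hv, by nlinarith⟩
    | one => exact ⟨1, one_mem _, by simp⟩
    | mul p q _ _ hp hq =>
      obtain ⟨v, hv, hvl⟩ := hp
      obtain ⟨w, hw, hwl⟩ := hq
      refine ⟨v * w, mul_mem hv hw, ?_⟩
      simp only [Prod.fst_mul, FreeMonoid.length_mul]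
      nlinarith

/-! ### Fellow travelling and the weak Lipschitz property -/

/-- A single step `(aᵢ, bᵢ)` of a path that spells a pair of words. -/
def pairStep {B : Type*} : B ⊕ B → Option B × Option B :=
  Sum.elim (fun a => (some a, none)) fun b => (none, some b)

theorem ofList_map_pairStep {B : Type*} (w : List (B ⊕ B)) :
    (FreeMonoid.ofList ((w.map pairStep).map Prod.fst).reduceOption,
      FreeMonoid.ofList ((w.map pairStep).map Prod.snd).reduceOption) =
      FreeMonoid.toProd (FreeMonoid.ofList w) := by
  induction w with
  | nil => rfl
  | cons x w ih =>
    rw [FreeMonoid.ofList_cons, map_mul, ← ih]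
    obtain a | b := x <;> rfl

theorem FreeMonoid.length_toProd {α β : Type*} (w : FreeMonoid (α ⊕ β)) :
    (toProd w).1.length + (toProd w).2.length = w.length := by
  induction w using FreeMonoid.inductionOn' with
  | one => simp
  | of_mul x w ih => obtain a | b := x <;> simp [← ih] <;> omega

theorem edist_mul_lift_le {B M : Type*} [Monoid M] (f : B → M) (g : M) (s : FreeMonoid B) :
    (cayleyGraph f).edist g (g * FreeMonoid.lift f s) ≤ s.length := by
  induction s using FreeMonoid.inductionOn' generalizing g with
  | one => simp
  | of_mul b s ih =>
    have h1 : (cayleyGraph f).edist g (g * f b) ≤ 1 := by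
      rw [SimpleGraph.edist_le_one_iff_adj_or_eq]
      by_cases h : g = g * f b
      · exact .inr h
      · exact .inl ((SimpleGraph.fromRel_adj _ _ _).2 ⟨h, .inl ⟨b, rfl⟩⟩)
    calc _ ≤ _ := SimpleGraph.edist_triangle (v := g * f b)
      _ ≤ 1 + (s.length : ℕ∞) := by
        refine add_le_add h1 ?_
        rw [map_mul, FreeMonoid.lift_eval_of, ← mul_assoc]
        exact ih _
      _ = _ := by simp [FreeMonoid.length_mul]

/-- The words `u` and `v` can be read simultaneously, one letter at a time, so that the elements
reached stay at distance at most `P`. -/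
def FellowTravel {B M : Type*} [Monoid M] (f : B → M) (P : ℕ) (u v : FreeSemigroup B) : Prop :=
  ∃ c : List (Option B × Option B),
    (∀ x ∈ c, (x.1 = none ↔ x.2 ≠ none)) ∧
    plusToStar u = FreeMonoid.ofList (c.map Prod.fst).reduceOption ∧
    plusToStar v = FreeMonoid.ofList (c.map Prod.snd).reduceOption ∧
    ∀ i ≤ c.length,
      (cayleyGraph f).edist
        (FreeMonoid.lift f (FreeMonoid.ofList ((c.take i).map Prod.fst).reduceOption))
        (FreeMonoid.lift f (FreeMonoid.ofList ((c.take i).map Prod.snd).reduceOption)) ≤ P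

namespace FellowTravel

variable {B M : Type*} [Monoid M] {f : B → M} {P P' : ℕ} {u v : FreeSemigroup B}

theorem mono (h : FellowTravel f P u v) (hP : P ≤ P') : FellowTravel f P' u v := by
  obtain ⟨c, h₁, h₂, h₃, h₄⟩ := h
  exact ⟨c, h₁, h₂, h₃, fun i hi => (h₄ i hi).trans (by exact_mod_cast hP)⟩

theorem symm (h : FellowTravel f P u v) : FellowTravel f P v u := by
  obtain ⟨c, h₁, h₂, h₃, h₄⟩ := h
  refine ⟨c.map Prod.swap, ?_, ?_, ?_, ?_⟩
  · intro x hx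
    obtain ⟨y, hy, rfl⟩ := List.mem_map.1 hx
    have := h₁ y hy
    simp only [Prod.fst_swap, Prod.snd_swap]
    tauto
  · rw [h₃, List.map_map]; rfl
  · rw [h₂, List.map_map]; rfl
  · intro i hi
    rw [SimpleGraph.edist_comm, ← List.map_take, List.map_map, List.map_map]
    exact h₄ i (by simpa using hi)

end FellowTravel

/-- Pairs in a rational relation whose values are at bounded distance fellow travel. -/
theorem IsRationalRelation.exists_fellowTravel {B M : Type*} [Monoid M] {f : B → M}
    {R : Set (FreeSemigroup B × FreeSemigroup B)} (hR : IsRationalRelation R) (d : ℕ)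
    (h : ∀ p ∈ R, (cayleyGraph f).edist (FreeSemigroup.lift f p.1) (FreeSemigroup.lift f p.2) ≤ d) :
    ∃ P, ∀ p ∈ R, FellowTravel f P p.1 p.2 := by
  obtain ⟨K, hK, hKR⟩ := IsRationalSubset.exists_image_eq (φ := FreeMonoid.toProd)
    FreeMonoid.toProd_surjective hR
  obtain ⟨N, hN⟩ := hK.exists_completion_bound
  -- The prefix `x` is completed by a word `s` of length at most `N` to a pair `q` of `R`: at most
  -- `N` from the first component of `x` to `q.1`, `d` from `q.1` to `q.2`, and `N` back to the
  -- second component of `x`.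
  refine ⟨N + d + N, fun p hp => ?_⟩
  obtain ⟨w, hw, hwp⟩ : Prod.map plusToStar plusToStar p ∈ FreeMonoid.toProd '' K :=
    hKR ▸ ⟨p, hp, rfl⟩
  have hc := (ofList_map_pairStep w.toList).trans hwp
  refine ⟨w.toList.map pairStep, ?_, (congrArg Prod.fst hc).symm, (congrArg Prod.snd hc).symm, ?_⟩
  · intro x hx
    obtain ⟨y, -, rfl⟩ := List.mem_map.1 hx
    obtain a | b := y <;> simp [pairStep]
  · intro i _
    obtain ⟨x, hx⟩ : ∃ x : FreeMonoid (B ⊕ B), x = FreeMonoid.ofList (List.take i w.toList) := ⟨_, rfl⟩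
    have hci := ofList_map_pairStep (List.take i w.toList)
    rw [← hx] at hci
    obtain ⟨hci₁, hci₂⟩ := Prod.mk.inj hci
    rw [← List.map_take, hci₁, hci₂]
    obtain ⟨s, hs, hxs⟩ := hN x (FreeMonoid.ofList (List.drop i w.toList))
      (by rw [hx, ← FreeMonoid.ofList_append, List.take_append_drop]; exact hw)
    obtain ⟨q, hq, hqs⟩ : FreeMonoid.toProd (x * s) ∈ Prod.map plusToStar plusToStar '' R :=
      hKR ▸ ⟨_, hxs, rfl⟩
    have hlen := FreeMonoid.length_toProd s
    have hd := h q hq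
    have e₁ : plusToStar q.1 = (FreeMonoid.toProd x).1 * (FreeMonoid.toProd s).1 := by
      simpa using congrArg Prod.fst hqs
    have e₂ : plusToStar q.2 = (FreeMonoid.toProd x).2 * (FreeMonoid.toProd s).2 := by
      simpa using congrArg Prod.snd hqs
    rw [← lift_plusToStar, ← lift_plusToStar, e₁, e₂, map_mul, map_mul] at hd
    have h₁ := edist_mul_lift_le f (FreeMonoid.lift f (FreeMonoid.toProd x).1)
      (FreeMonoid.toProd s).1
    have h₂ := edist_mul_lift_le f (FreeMonoid.lift f (FreeMonoid.toProd x).2)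
      (FreeMonoid.toProd s).2
    rw [SimpleGraph.edist_comm] at h₂
    have l₁ : ((FreeMonoid.toProd s).1.length : ℕ∞) ≤ N := by exact_mod_cast (by omega)
    have l₂ : ((FreeMonoid.toProd s).2.length : ℕ∞) ≤ N := by exact_mod_cast (by omega)
    push_cast
    exact (SimpleGraph.edist_triangle.trans (add_le_add
      (SimpleGraph.edist_triangle.trans (add_le_add h₁ hd)) h₂)).trans
      (add_le_add (add_le_add l₁ le_rfl) l₂)

/-- Quasi-automatic structures on monoids have the weak Lipschitz property. -/
theorem QuasiAutomaticStructure.exists_weakLipschitzWith {B M : Type*} [Finite B] [Monoid M]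
    {f : B → M} (Q : QuasiAutomaticStructure f) : ∃ P, WeakLipschitzWith f Q.L P := by
  cases nonempty_fintype B
  obtain ⟨P, hP⟩ := Q.rational_R.exists_fellowTravel (f := f) 0 (by
    intro p hp
    rw [Q.R_eq] at hp
    simp [hp.2.2])
  have hgen : ∀ b, ∃ P, ∀ p ∈ Q.Rgen b, FellowTravel f P p.1 p.2 := by
    refine fun b => (Q.rational_Rgen b).exists_fellowTravel (f := f) 1 fun p hp => ?_
    rw [Q.Rgen_eq] at hp
    have := edist_mul_lift_le f (FreeSemigroup.lift f p.1) (FreeMonoid.of b)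
    rw [← hp.2.2, map_mul, FreeSemigroup.lift_of]
    simpa using this
  choose P' hP' using hgen
  -- The sum is a common upper bound for the finitely many constants.
  refine ⟨P + ∑ b, P' b, fun u hu v hv huv => ?_⟩
  have hle : ∀ b, P' b ≤ P + ∑ b, P' b := fun b =>
    (Finset.single_le_sum (fun _ _ => Nat.zero_le _) (Finset.mem_univ b)).trans (Nat.le_add_left _ _)
  have key : ∀ u ∈ Q.L, ∀ v ∈ Q.L, ∀ b, FreeSemigroup.lift f u * f b = FreeSemigroup.lift f v →
      FellowTravel f (P + ∑ b, P' b) u v := by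
    intro u hu v hv b h
    refine (hP' b (u, v) ?_).mono (hle b)
    rw [Q.Rgen_eq]
    exact ⟨hu, hv, by rw [map_mul, FreeSemigroup.lift_of, h]⟩
  rw [SimpleGraph.edist_le_one_iff_adj_or_eq] at huv
  obtain h | h := huv
  · obtain ⟨-, ⟨b, h⟩ | ⟨b, h⟩⟩ := (SimpleGraph.fromRel_adj _ _ _).1 h
    · exact key u hu v hv b h
    · exact (key v hv u hu b h).symm
  · refine (hP (u, v) ?_).mono (Nat.le_add_right _ _)
    rw [Q.R_eq]
    exact ⟨hu, hv, h⟩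

/-! ### Counting conjugates of relators -/

section ConjugateProducts

/-- `g` is a product of at most `n` conjugates of elements of `E`. -/
def IsConjProd {H : Type*} [Group H] (E : Set H) (n : ℕ) (g : H) : Prop :=
  ∃ l : List (H × H), l.length ≤ n ∧ (∀ p ∈ l, p.2 ∈ E) ∧
    (l.map (fun p => p.1 * p.2 * p.1⁻¹)).prod = g

namespace IsConjProd

variable {H : Type*} [Group H] {E : Set H} {m n : ℕ} {g h : H}

theorem one : IsConjProd E n 1 := ⟨[], by simp, by simp, by simp⟩

theorem of_mem (y : H) (hg : g ∈ E) : IsConjProd E 1 (y * g * y⁻¹) :=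
  ⟨[(y, g)], by simp, by simpa using hg, by simp⟩

theorem mono (hg : IsConjProd E m g) (hmn : m ≤ n) : IsConjProd E n g := by
  obtain ⟨l, h₁, h₂⟩ := hg
  exact ⟨l, h₁.trans hmn, h₂⟩

theorem mul (hg : IsConjProd E m g) (hh : IsConjProd E n h) : IsConjProd E (m + n) (g * h) := by
  obtain ⟨l, h₁, h₂, rfl⟩ := hg
  obtain ⟨l', h₁', h₂', rfl⟩ := hh
  refine ⟨l ++ l', by simp; omega, ?_, by simp⟩
  intro p hp
  obtain hp | hp := List.mem_append.1 hp
  exacts [h₂ p hp, h₂' p hp]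

theorem conj (y : H) (hg : IsConjProd E n g) : IsConjProd E n (y * g * y⁻¹) := by
  obtain ⟨l, h₁, h₂, rfl⟩ := hg
  refine ⟨l.map fun p => (y * p.1, p.2), by simpa using h₁, ?_, ?_⟩
  · intro p hp
    obtain ⟨q, hq, rfl⟩ := List.mem_map.1 hp
    exact h₂ q hq
  · rw [← MulAut.conj_apply, map_list_prod, List.map_map, List.map_map]
    congr 2
    ext p
    simp [mul_assoc]

theorem mem_normalClosure (hg : IsConjProd E n g) : g ∈ Subgroup.normalClosure E := by
  obtain ⟨l, -, h₂, rfl⟩ := hg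
  refine Subgroup.list_prod_mem _ fun x hx => ?_
  obtain ⟨p, hp, rfl⟩ := List.mem_map.1 hx
  exact Subgroup.normalClosure_normal.conj_mem _ (Subgroup.subset_normalClosure (h₂ p hp)) _

end IsConjProd

end ConjugateProducts

/-! ### Filling relators with short cells -/

section Relators

variable {A G : Type*} [Group G] {ν : FreeGroup A →* G}

/-- The natural homomorphism from words in `A ⊔ A⁻¹` to `F(A)`. -/
def wordToFree : FreeMonoid (A × Bool) →* FreeGroup A :=
  FreeMonoid.lift fun x => FreeGroup.mk [x]

theorem map_wordToFree (ν : FreeGroup A →* G) (w : FreeMonoid (A × Bool)) :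
    ν (wordToFree w) = FreeMonoid.lift (signedGenerators ν) w :=
  FreeMonoid.hom_map_lift ν _ w

/-- Each step advances exactly one of the two words. -/
theorem length_add_length_of_pairs {B : Type*} (c : List (Option B × Option B))
    (hc : ∀ x ∈ c, (x.1 = none ↔ x.2 ≠ none)) :
    (c.map Prod.fst).reduceOption.length + (c.map Prod.snd).reduceOption.length = c.length := by
  induction c with
  | nil => rfl
  | cons x c ih =>
    have hx := hc x List.mem_cons_self
    have := ih fun y hy => hc y (List.mem_cons_of_mem _ hy)
    obtain ⟨_ | a, _ | b⟩ := x
    · simp at hx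
    · simp; omega
    · simp; omega
    · simp at hx

variable [DecidableEq A]

theorem norm_wordToFree_le (w : FreeMonoid (A × Bool)) : (wordToFree w).norm ≤ w.length := by
  induction w using FreeMonoid.inductionOn' with
  | one => simp
  | of_mul x w ih =>
    rw [map_mul, FreeMonoid.length_mul]
    exact (FreeGroup.norm_mul_le _ _).trans (add_le_add FreeGroup.norm_mk_le ih)

theorem finite_relatorsUpTo [Finite A] (ν : FreeGroup A →* G) (m : ℕ) :
    (relatorsUpTo ν m).Finite := by
  refine Set.Finite.of_finite_image (f := FreeGroup.toWord)
    ((List.finite_length_le (A × Bool) m).subset ?_) FreeGroup.toWord_injective.injOn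
  rintro _ ⟨x, hx, rfl⟩
  exact hx.2

theorem exists_norm_le_of_edist_le {g h : G} {P : ℕ}
    (hgh : (cayleyGraph (signedGenerators ν)).edist g h ≤ P) :
    ∃ w : FreeGroup A, w.norm ≤ P ∧ g * ν w = h := by
  obtain ⟨p, hp⟩ := SimpleGraph.exists_walk_of_edist_ne_top
    (ne_top_of_le_ne_top (ENat.natCast_ne_top P) hgh)
  rw [← hp] at hgh
  have hP : p.length ≤ P := by exact_mod_cast hgh
  suffices ∃ w : FreeGroup A, w.norm ≤ p.length ∧ g * ν w = h by
    obtain ⟨w, hw, hwg⟩ := this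
    exact ⟨w, hw.trans hP, hwg⟩
  clear hgh hp hP
  induction p with
  | nil => exact ⟨1, by simp, by simp⟩
  | @cons a b c hab p ih =>
    obtain ⟨w, hw, rfl⟩ := ih
    obtain ⟨-, ⟨x, rfl⟩ | ⟨x, rfl⟩⟩ := (SimpleGraph.fromRel_adj _ _ _).1 hab
    · refine ⟨FreeGroup.mk [x] * w, (FreeGroup.norm_mul_le _ _).trans ?_, ?_⟩
      · have : (FreeGroup.mk [x]).norm ≤ 1 := FreeGroup.norm_mk_le
        rw [SimpleGraph.Walk.length_cons]
        omega
      · rw [map_mul, ← mul_assoc, signedGenerators]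
    · refine ⟨(FreeGroup.mk [x])⁻¹ * w, (FreeGroup.norm_mul_le _ _).trans ?_, ?_⟩
      · have : (FreeGroup.mk [x]).norm ≤ 1 := FreeGroup.norm_mk_le
        rw [SimpleGraph.Walk.length_cons, FreeGroup.norm_inv_eq]
        omega
      · rw [map_mul, map_inv, ← mul_assoc, signedGenerators, mul_inv_cancel_right]

/-- The strip between the paths `u` and `v` is cut by connecting words `w` of length at most `P`,
one for each time `i`. Each step contributes one cell, and there are `|u| + |v|` steps; one more
cell replaces the last connecting word by `y`. -/
theorem isConjProd_of_fellowTravel {P : ℕ} {u v : FreeSemigroup (A × Bool)}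
    (huv : FellowTravel (signedGenerators ν) P u v) {y : FreeGroup A} (hy : y.norm ≤ 1)
    (h : FreeSemigroup.lift (signedGenerators ν) u * ν y =
      FreeSemigroup.lift (signedGenerators ν) v) :
    IsConjProd (relatorsUpTo ν (2 * P + 2)) ((plusToStar u).length + (plusToStar v).length + 1)
      (wordToFree (plusToStar u) * y * (wordToFree (plusToStar v))⁻¹) := by
  obtain ⟨c, hc, hu, hv, hd⟩ := huv
  have key : ∀ i ≤ c.length, ∃ w : FreeGroup A, w.norm ≤ P ∧
      ν (wordToFree (FreeMonoid.ofList ((c.take i).map Prod.fst).reduceOption)) * ν w =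
        ν (wordToFree (FreeMonoid.ofList ((c.take i).map Prod.snd).reduceOption)) ∧
      IsConjProd (relatorsUpTo ν (2 * P + 2)) i
        (wordToFree (FreeMonoid.ofList ((c.take i).map Prod.fst).reduceOption) * w *
        (wordToFree (FreeMonoid.ofList ((c.take i).map Prod.snd).reduceOption))⁻¹) := by
    intro i
    induction i with
    | zero => exact fun _ => ⟨1, by simp, by simp, by simpa using IsConjProd.one⟩
    | succ i ih =>
      intro hi
      obtain ⟨w, hw, hνw, hprod⟩ := ih (by omega)
      obtain ⟨w', hw', hνw'⟩ := exists_norm_le_of_edist_le (hd (i + 1) hi)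
      rw [← map_wordToFree, ← map_wordToFree] at hνw'
      refine ⟨w', hw', hνw', ?_⟩
      obtain ⟨z, hz⟩ : ∃ z, z = c.get ⟨i, hi⟩ := ⟨_, rfl⟩
      have hx := length_add_length_of_pairs [z]
        (fun x hx => hc x (by rw [List.mem_singleton.1 hx, hz]; exact List.get_mem _ _))
      obtain ⟨a, ha⟩ : ∃ a, a = FreeMonoid.ofList ([z].map Prod.fst).reduceOption := ⟨_, rfl⟩
      obtain ⟨b, hb⟩ : ∃ b, b = FreeMonoid.ofList ([z].map Prod.snd).reduceOption := ⟨_, rfl⟩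
      have hab : a.length + b.length = 1 := by rw [ha, hb]; exact hx
      rw [List.take_succ_eq_append_getElem hi, ← List.get_eq_getElem (i := ⟨i, hi⟩), ← hz,
        List.map_append, List.map_append,
        List.reduceOption_append, List.reduceOption_append, FreeMonoid.ofList_append,
        FreeMonoid.ofList_append, ← ha, ← hb] at hνw' ⊢
      generalize FreeMonoid.ofList ((c.take i).map Prod.fst).reduceOption = α at *
      generalize FreeMonoid.ofList ((c.take i).map Prod.snd).reduceOption = β at *
      have na := norm_wordToFree_le a
      have nb := norm_wordToFree_le b
      simp only [map_mul] at hνw' ⊢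
      generalize wordToFree a = a' at *
      generalize wordToFree b = b' at *
      -- The cell between times `i` and `i + 1`. One of `a'` and `b'` is trivial and the other is a
      -- letter, so its length is at most `2 * P + 1`.
      have hrel : a' * w' * b'⁻¹ * w⁻¹ ∈ relatorsUpTo ν (2 * P + 2) := by
        constructor
        · have e : ν a' * ν w' = (ν (wordToFree α))⁻¹ * (ν (wordToFree β) * ν b') := by
            rw [← hνw']; group
          rw [map_mul, map_mul, map_mul, map_inv, map_inv, e, ← hνw]
          group
        · have n₁ := FreeGroup.norm_mul_le (a' * w' * b'⁻¹) w⁻¹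
          have n₂ := FreeGroup.norm_mul_le (a' * w') b'⁻¹
          have n₃ := FreeGroup.norm_mul_le a' w'
          rw [FreeGroup.norm_inv_eq] at n₁ n₂
          omega
      convert ((IsConjProd.of_mem (wordToFree α) hrel).mul hprod).mono (by omega : 1 + i ≤ i + 1)
        using 1
      group
  obtain ⟨w, hw, hνw, hprod⟩ := key c.length le_rfl
  rw [List.take_length, ← hu, ← hv] at hprod hνw
  have hlen := length_add_length_of_pairs c hc
  have hu' : (plusToStar u).length = (c.map Prod.fst).reduceOption.length := by rw [hu]; rfl
  have hv' : (plusToStar v).length = (c.map Prod.snd).reduceOption.length := by rw [hv]; rfl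
  rw [← lift_plusToStar, ← lift_plusToStar, ← map_wordToFree, ← map_wordToFree] at h
  -- The cell at the end of the strip, of length at most `P + 1`.
  have hrel : y * w⁻¹ ∈ relatorsUpTo ν (2 * P + 2) := by
    constructor
    · rw [← h] at hνw
      rw [map_mul, map_inv, mul_left_cancel hνw, mul_inv_cancel]
    · have := FreeGroup.norm_mul_le y w⁻¹
      rw [FreeGroup.norm_inv_eq] at this
      omega
  convert ((IsConjProd.of_mem (wordToFree (plusToStar u)) hrel).mul hprod).mono
    (show 1 + c.length ≤ (plusToStar u).length + (plusToStar v).length + 1 by omega) using 1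
  group

/-- An arbitrary representative of the product may be very long, but `R_b` is rational, so
`IsRationalSubset.exists_length_bound` provides a short one related to the same `u`. -/
theorem QuasiAutomaticStructure.exists_successor_bound {B S : Type*} [Finite B] [Semigroup S]
    {f : B → S} (Q : QuasiAutomaticStructure f) :
    ∃ C : ℕ, ∀ u ∈ Q.L, ∀ b, ∃ v ∈ Q.L,
      FreeSemigroup.lift f u * f b = FreeSemigroup.lift f v ∧
      (plusToStar v).length ≤ C * ((plusToStar u).length + 1) := by
  cases nonempty_fintype B
  choose C hC using fun b => IsRationalSubset.exists_length_bound (Q.rational_Rgen b)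
  refine ⟨∑ b, C b, fun u hu b => ?_⟩
  obtain ⟨v, hv, huv⟩ := Q.exists_mem_lift_eq (FreeSemigroup.lift f u * f b)
  have hmem : (u, v) ∈ Q.Rgen b := by
    rw [Q.Rgen_eq]
    exact ⟨hu, hv, by rw [map_mul, FreeSemigroup.lift_of, huv]⟩
  obtain ⟨y, ⟨⟨u', v'⟩, huv', h⟩, hlen⟩ := hC b _ ⟨_, hmem, rfl⟩
  obtain rfl : u' = u := plusToStar_injective (congrArg Prod.fst h)
  obtain rfl : plusToStar v' = y := congrArg Prod.snd h
  rw [Q.Rgen_eq] at huv'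
  obtain ⟨-, hv', huv'⟩ := huv'
  refine ⟨v', hv', by rw [← huv', map_mul, FreeSemigroup.lift_of], hlen.trans ?_⟩
  exact Nat.mul_le_mul_right _ (Finset.single_le_sum (fun _ _ => Nat.zero_le _) (Finset.mem_univ b))

/-- Starting from a representative `u₀` of the identity, a word is followed letter by letter through
representatives of its prefixes. Their lengths grow at most geometrically, hence so does the total
number of cells in the strips between them. -/
theorem WeakLipschitzWith.exponentialIsoperimetricInequality [Finite A]
    (Q : QuasiAutomaticStructure (signedGenerators ν)) {P : ℕ}
    (hP : WeakLipschitzWith (signedGenerators ν) Q.L P) :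
    ExponentialIsoperimetricInequality ν (relatorsUpTo ν (2 * P + 2)) := by
  obtain ⟨C, hC⟩ := Q.exists_successor_bound
  obtain ⟨u₀, hu₀, hu₀1⟩ := Q.exists_mem_lift_eq 1
  obtain ⟨M, hM⟩ : ∃ M, M = (plusToStar u₀).length + 1 := ⟨_, rfl⟩
  have key : ∀ l : List (A × Bool), ∃ v ∈ Q.L,
      ν (FreeGroup.mk l) = FreeSemigroup.lift (signedGenerators ν) v ∧
      (plusToStar v).length + 1 ≤ (C + 1) ^ l.length * M ∧
      -- The strip for the letter after `l` has at most `(C + 2) * (C + 1) ^ l.length * M` cells.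
      -- Enlarging the base to `C + 3` makes the induction close, as `1 + (C + 2) = C + 3`.
      IsConjProd (relatorsUpTo ν (2 * P + 2)) (M * (C + 3) ^ l.length)
        (wordToFree (plusToStar u₀) * FreeGroup.mk l * (wordToFree (plusToStar v))⁻¹) := by
    intro l
    induction l using List.reverseRecOn with
    | nil =>
      refine ⟨u₀, hu₀, ?_, by simp [hM], ?_⟩
      · rw [hu₀1]
        exact map_one ν
      · rw [← FreeGroup.one_eq_mk, mul_one, mul_inv_cancel]
        exact .one
    | append_singleton l x ih =>
      obtain ⟨u, hu, hνu, hlen, hprod⟩ := ih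
      obtain ⟨v, hv, huv, hlen'⟩ := hC u hu x
      have hbound : (plusToStar v).length + 1 ≤ (C + 1) * ((plusToStar u).length + 1) := by
        rw [add_mul]
        omega
      have hbound' := hbound.trans (Nat.mul_le_mul_left (C + 1) hlen)
      have hstep := isConjProd_of_fellowTravel (hP u hu v hv ?_) (y := FreeGroup.mk [x])
        FreeGroup.norm_mk_le huv
      · refine ⟨v, hv, ?_, ?_, ?_⟩
        · rw [← FreeGroup.mul_mk, map_mul, hνu, ← huv, signedGenerators]
        · rw [List.length_append, List.length_singleton, pow_succ']
          exact hbound'.trans_eq (mul_assoc ..).symm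
        · rw [← FreeGroup.mul_mk]
          convert (hprod.mul hstep).mono _ using 1
          · group
          · rw [List.length_append, List.length_singleton]
            have hpow : (C + 1) ^ l.length ≤ (C + 3) ^ l.length := Nat.pow_le_pow_left (by omega) _
            have h₁ : (plusToStar u).length + (plusToStar v).length + 1 ≤
                (C + 2) * ((C + 1) ^ l.length * M) := by
              rw [show C + 2 = (C + 1) + 1 from rfl, add_mul _ 1, one_mul]
              omega
            calc _ ≤ M * (C + 3) ^ l.length + (C + 2) * ((C + 3) ^ l.length * M) := by
                  exact Nat.add_le_add_left (h₁.trans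
                    (Nat.mul_le_mul_left _ (Nat.mul_le_mul_right _ hpow))) _
              _ = M * (C + 3) ^ (l.length + 1) := by ring
      · have := edist_mul_lift_le (signedGenerators ν)
          (FreeSemigroup.lift (signedGenerators ν) u) (FreeMonoid.of x)
        rw [FreeMonoid.lift_eval_of, huv] at this
        simpa using this
  -- With the closing strip there are at most `3 * M * (C + 3) ^ k` cells. The factor `3 * M` is
  -- absorbed into the base when `k ≥ 1`; for `k = 0` the empty product suffices.
  refine ⟨3 * M * (C + 3), fun g hg => ?_⟩
  change IsConjProd (relatorsUpTo ν (2 * P + 2)) _ g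
  obtain rfl | hg1 := eq_or_ne g 1
  · exact .one
  obtain ⟨v, hv, hνv, hlen, hprod⟩ := key g.toWord
  rw [FreeGroup.mk_toWord, MonoidHom.mem_ker.1 hg] at hνv
  rw [FreeGroup.mk_toWord] at hprod
  -- Since `g` is a relator, its last representative `v` has the same value as `u₀`. A strip with `y
  -- = 1` closes the loop and gives `u₀ g u₀⁻¹`, a conjugate of `g`.
  have hend := isConjProd_of_fellowTravel (hP v hv u₀ hu₀ ?_) (y := 1) (by simp)
    (by rw [map_one, mul_one, ← hνv, hu₀1])
  · convert ((hprod.mul hend).conj (wordToFree (plusToStar u₀))⁻¹).mono _ using 1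
    · group
    · have hk : g.norm ≠ 0 := fun h => hg1 (FreeGroup.norm_eq_zero.1 h)
      change _ ≤ (3 * M * (C + 3)) ^ g.norm
      change _ ≤ (C + 1) ^ g.norm * M at hlen
      change M * (C + 3) ^ g.norm + _ ≤ _
      have hpow : (C + 1) ^ g.norm ≤ (C + 3) ^ g.norm := Nat.pow_le_pow_left (by omega) _
      have h₁ : 1 ≤ (C + 3) ^ g.norm := Nat.one_le_pow _ _ (by omega)
      have h₂ : 3 * M ≤ (3 * M) ^ g.norm := Nat.le_self_pow hk _
      rw [mul_pow]
      calc _ ≤ 3 * M * (C + 3) ^ g.norm := by nlinarith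
        _ ≤ _ := Nat.mul_le_mul_right _ h₂
  · rw [hu₀1, ← hνv, SimpleGraph.edist_self]
    exact zero_le

theorem WeakLipschitzWith.normalClosure_relatorsUpTo [Finite A]
    (Q : QuasiAutomaticStructure (signedGenerators ν)) {P : ℕ}
    (hP : WeakLipschitzWith (signedGenerators ν) Q.L P) :
    Subgroup.normalClosure (relatorsUpTo ν (2 * P + 2)) = ν.ker := by
  refine le_antisymm (Subgroup.normalClosure_le_normal fun x hx => hx.1) fun g hg => ?_
  obtain ⟨C, hC⟩ := WeakLipschitzWith.exponentialIsoperimetricInequality Q hP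
  exact IsConjProd.mem_normalClosure (hC g hg)

end Relators

/-! ### Passage to group generators and conclusion -/

theorem IsQuasiAutomatic.nonempty_structure {A G : Type*} [Group G] [Nonempty A]
    (hG : IsQuasiAutomatic G) {ν : FreeGroup A →* G} (hν : Function.Surjective ν) :
    Nonempty (QuasiAutomaticStructure (signedGenerators ν)) := by
  obtain ⟨X, hX, hXtop, ⟨Q⟩⟩ := hG
  have := hX.to_subtype
  exact Q.nonempty_of_generators (fun a => exists_lift_signedGenerators_eq hν _)
    (fun b => exists_lift_eq_of_closure_eq_top hXtop _)

theorem IsQuasiAutomatic.exists_surjective_freeGroup {G : Type*} [Group G]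
    (hG : IsQuasiAutomatic G) : ∃ (n : ℕ) (_ : Nonempty (Fin n)) (ν : FreeGroup (Fin n) →* G),
      Function.Surjective ν := by
  obtain ⟨X, hX, hXtop, -⟩ := hG
  have := hX.to_subtype
  obtain ⟨n, ⟨e⟩⟩ := Finite.exists_equiv_fin X
  -- The first letter of a nonempty word representing `1` shows that `X` is nonempty.
  obtain ⟨w₁, -⟩ := exists_lift_eq_of_closure_eq_top hXtop 1
  refine ⟨n, ⟨e w₁.head⟩, FreeGroup.lift fun i => (e.symm i : G), fun g => ?_⟩
  obtain ⟨w, rfl⟩ := exists_lift_eq_of_closure_eq_top hXtop g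
  induction w using FreeSemigroup.recOnMul with
  | ih1 x => exact ⟨FreeGroup.of (e x), by simp⟩
  | ih2 x w hx hw =>
    obtain ⟨y, hy⟩ := hx
    obtain ⟨z, hz⟩ := hw
    exact ⟨y * z, by rw [map_mul, map_mul, hy, hz]⟩

/-- A group that is a quasi-automatic semigroup is finitely presented with an exponential
isoperimetric inequality; for every finite nonempty group generating family `A`, there is a
quasi-automatic structure with respect to `A ⊔ A⁻¹`, and for each such structure the relators of
length at most `2 * P + 2`, where `P` is any constant for the weak Lipschitz property, form such a
presentation. -/
theorem mainTheorem2 {G : Type*} [Group G] (hG : IsQuasiAutomatic G) :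
    Group.IsFinitelyPresented G ∧
    (∃ (n : ℕ) (ν : FreeGroup (Fin n) →* G) (E : Set (FreeGroup (Fin n))),
      Function.Surjective ν ∧ E.Finite ∧ Subgroup.normalClosure E = ν.ker ∧
        ExponentialIsoperimetricInequality ν E) ∧
    ∀ (A : Type*) [Finite A] [Nonempty A] [DecidableEq A] (ν : FreeGroup A →* G),
      Function.Surjective ν →
      Nonempty (QuasiAutomaticStructure (signedGenerators ν)) ∧
      ∀ Q : QuasiAutomaticStructure (signedGenerators ν),
        (∃ P : ℕ, WeakLipschitzWith (signedGenerators ν) Q.L P) ∧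
        ∀ P : ℕ, WeakLipschitzWith (signedGenerators ν) Q.L P →
          (relatorsUpTo ν (2 * P + 2)).Finite ∧
          Subgroup.normalClosure (relatorsUpTo ν (2 * P + 2)) = ν.ker ∧
          ExponentialIsoperimetricInequality ν (relatorsUpTo ν (2 * P + 2)) := by
  obtain ⟨n, _, ν, hν⟩ := hG.exists_surjective_freeGroup
  obtain ⟨Q⟩ := hG.nonempty_structure hν
  obtain ⟨P, hP⟩ := Q.exists_weakLipschitzWith
  have hE := finite_relatorsUpTo ν (2 * P + 2)
  have hEν := WeakLipschitzWith.normalClosure_relatorsUpTo Q hP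
  refine ⟨⟨n, ν, hν, _, hE, hEν⟩, ⟨n, ν, _, hν, hE, hEν,
    WeakLipschitzWith.exponentialIsoperimetricInequality Q hP⟩, ?_⟩
  intro A _ _ _ ν hν
  exact ⟨hG.nonempty_structure hν, fun Q => ⟨Q.exists_weakLipschitzWith, fun P hP =>
    ⟨finite_relatorsUpTo ν _, WeakLipschitzWith.normalClosure_relatorsUpTo Q hP,
      WeakLipschitzWith.exponentialIsoperimetricInequality Q hP⟩⟩⟩
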